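/- Let $f,g$ be non-degenerate real quadratic forms in three variables, and write $\operatorname{Mat}(q)$ for the symmetric matrix of a form $q$. Put $$\phi(t)=\det\operatorname{Mat}(tf+g)=\Phi_{30}t^3+\Phi_{21}t^2+\Phi_{12}t+\Phi_{03},$$ and let $\psi(t)$ be the coefficient of $v$ in $\det\big(vI-\operatorname{Mat}(tf+g)\big)$. Let $P=p_2t^2+p_1t+p_0$ be the remainder of $\Phi_{30}\,\psi\,\phi'$ in the Euclidean division by $\phi$, and set $$A_1=\begin{vmatrix}\Phi_{30}&\Phi_{21}&\Phi_{12}\\0&p_2&p_1\\p_2&p_1&p_0\end{vmatrix},\qquad A_0=\begin{vmatrix}\Phi_{30}&\Phi_{21}&\Phi_{12}&\Phi_{03}&0\\0&\Phi_{30}&\Phi_{21}&\Phi_{12}&\Phi_{03}\\0&0&p_2&p_1&p_0\\0&p_2&p_1&p_0&0\\p_2&p_1&p_0&0&0\end{vmatrix}.$$ A pencil is a plane of real ternary quadratic forms; $PGL(3,\mathbb R)$ acts on pencils by linear change of coordinates. Orbit I is the orbit of the pencil generated by $x^2-y^2$ and $x^2-z^2$ (four distinct real base points), and orbit Ia is the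 orbit of the pencil generated by $x^2+y^2+z^2$ and $xz$ (four distinct imaginary base points). Suppose that the pencil generated by $f$ and $g$ is in orbit I or in orbit Ia. Then: 1. $A_0<0$; 2. the pencil is in orbit I if and only if $p_2<0$ and $\Phi_{30}A_1>0$; 3. the pencil is in orbit Ia if and only if $p_2>0$, or $\Phi_{30}A_1<0$, or $p_2=A_1=0$. -/

import Mathlib

open Polynomial

/-- A real ternary quadratic form. -/
abbrev TernaryForm : Type := QuadraticForm ℝ (Fin 3 → ℝ)

namespace ConicPencil

/-- The linear map `Q ↦ Q ∘ e` on ternary quadratic forms induced by a linear change of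
coordinates `e`. -/
def pullback (e : (Fin 3 → ℝ) ≃ₗ[ℝ] (Fin 3 → ℝ)) : TernaryForm →ₗ[ℝ] TernaryForm where
  toFun Q := Q.comp e.toLinearMap
  map_add' _ _ := rfl
  map_smul' _ _ := rfl

/-- The plane of quadratic forms generated by `f` and `g`. -/
def pencil (f g : TernaryForm) : Submodule ℝ TernaryForm := Submodule.span ℝ {f, g}

/-- Two pencils are projectively equivalent if some linear automorphism of `ℝ³` carries one to
the other (scalar automorphisms fix every pencil, so this is the relation of lying in the same
`PGL(3, ℝ)`-orbit). -/
def ProjEquiv (L L' : Submodule ℝ TernaryForm) : Prop :=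
  ∃ e : (Fin 3 → ℝ) ≃ₗ[ℝ] (Fin 3 → ℝ), L.map (pullback e) = L'

/-- The monomial `xᵢ xⱼ` as a ternary quadratic form, where `(x₀, x₁, x₂) = (x, y, z)`. -/
noncomputable def mon (i j : Fin 3) : TernaryForm := QuadraticMap.proj i j

/-- The orbit of the pencil generated by `x² - y²` and `x² - z²` (four real base points). -/
def OrbitI (L : Submodule ℝ TernaryForm) : Prop :=
  ProjEquiv (pencil (mon 0 0 - mon 1 1) (mon 0 0 - mon 2 2)) L

/-- The orbit of the pencil generated by `x² + y² + z²` and `x z` (four imaginary base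
points, each of multiplicity one). -/
def OrbitIa (L : Submodule ℝ TernaryForm) : Prop :=
  ProjEquiv (pencil (mon 0 0 + mon 1 1 + mon 2 2) (mon 0 2)) L

/-- The symmetric matrix of the form `t f + g`, with entries in `ℝ[t]`. -/
noncomputable def pencilMatrix (f g : TernaryForm) : Matrix (Fin 3) (Fin 3) ℝ[X] :=
  (X : ℝ[X]) • f.toMatrix'.map C + g.toMatrix'.map C

/-- The dehomogenized characteristic form `φ(t) = Disc (t f + g)`. -/
noncomputable def phi (f g : TernaryForm) : ℝ[X] := (pencilMatrix f g).det

/-- The coefficient `ψ(t)` of `v` in `det (v I - Matrix (t f + g))`. -/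
noncomputable def psi (f g : TernaryForm) : ℝ[X] := (pencilMatrix f g).charpoly.coeff 1

/-- The coefficient `Φ₃₀` of `t³` in the characteristic form. -/
noncomputable def Phi30 (f g : TernaryForm) : ℝ := (phi f g).coeff 3

/-- The remainder `P` of `Φ₃₀ ψ φ'` in the Euclidean division by `φ`. -/
noncomputable def P (f g : TernaryForm) : ℝ[X] :=
  (C (Phi30 f g) * psi f g * derivative (phi f g)) % phi f g

/-- The signed subresultant principal coefficient `sr₁(V, W)`, for `V` of degree `3` and `W` of
degree at most `2`. -/
noncomputable def sr1 (V W : ℝ[X]) : ℝ :=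
  Matrix.det !![V.coeff 3, V.coeff 2, V.coeff 1;
                0,         W.coeff 2, W.coeff 1;
                W.coeff 2, W.coeff 1, W.coeff 0]

/-- The signed subresultant principal coefficient `sr₀(V, W)`, for `V` of degree `3` and `W` of
degree at most `2`. -/
noncomputable def sr0 (V W : ℝ[X]) : ℝ :=
  Matrix.det !![V.coeff 3, V.coeff 2, V.coeff 1, V.coeff 0, 0;
                0,         V.coeff 3, V.coeff 2, V.coeff 1, V.coeff 0;
                0,         0,         W.coeff 2, W.coeff 1, W.coeff 0;
                0,         W.coeff 2, W.coeff 1, W.coeff 0, 0;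
                W.coeff 2, W.coeff 1, W.coeff 0, 0,         0]

/-- The coefficient `p₂` of `t²` in `P`. -/
noncomputable def p2 (f g : TernaryForm) : ℝ := (P f g).coeff 2

/-- `A₁ = sr₁(φ, P)`. -/
noncomputable def A1 (f g : TernaryForm) : ℝ := sr1 (phi f g) (P f g)

/-- `A₀ = sr₀(φ, P)`. -/
noncomputable def A0 (f g : TernaryForm) : ℝ := sr0 (phi f g) (P f g)

end ConicPencil

namespace ConicPencil

open Matrix

/-! ### The subresultants in terms of the roots of the characteristic form -/

/-! In both orbits `φ` has three distinct real roots `tᵢ`, one per degenerate conic of the pencil.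
There the matrix has rank two and its adjugate is `c • v vᵀ`, with `v` the vertex of the line pair;
`ψ(tᵢ)` is its trace `sᵢ`, negative for real lines and positive for conjugate imaginary lines. Orbit
I gives signs `(-,-,-)`, orbit Ia gives `(-,+,+)`. By `subresultants_eq`, `p₂`, `Φ₃₀A₁` and `A₀`
are, up to positive factors, the leading principal minors of the Hankel matrix `∑ sᵢ tᵢ^(j+k)`, so
they detect these signs. The two resulting sets of conditions exclude each other, which gives the
converses. -/

theorem remainder_eq {a t₁ t₂ t₃ : ℝ} (ha : a ≠ 0) (h₁₂ : t₁ ≠ t₂) (h₁₃ : t₁ ≠ t₃) (h₂₃ : t₂ ≠ t₃)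
    {φ : ℝ[X]} (hφ : φ = C a * ((X - C t₁) * (X - C t₂) * (X - C t₃))) (ψ : ℝ[X]) :
    (C a * ψ * derivative φ) % φ =
      C (a ^ 2 * (ψ.eval t₁ + ψ.eval t₂ + ψ.eval t₃)) * X ^ 2 +
      C (-a ^ 2 * (ψ.eval t₁ * (t₂ + t₃) + ψ.eval t₂ * (t₁ + t₃) + ψ.eval t₃ * (t₁ + t₂))) * X +
      C (a ^ 2 * (ψ.eval t₁ * (t₂ * t₃) + ψ.eval t₂ * (t₁ * t₃) + ψ.eval t₃ * (t₁ * t₂))) := by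
  have hdeg : φ.degree = 3 := by
    rw [hφ, degree_C_mul ha, degree_mul, degree_mul, degree_X_sub_C, degree_X_sub_C,
      degree_X_sub_C]
    rfl
  have hφ0 : φ ≠ 0 := by
    rintro rfl
    simp at hdeg
  have heval : ∀ t, φ.eval t = 0 → ((C a * ψ * derivative φ) % φ).eval t =
      a * ψ.eval t * (derivative φ).eval t := by
    intro t ht
    have h := congrArg (eval t) (EuclideanDomain.mod_add_div (C a * ψ * derivative φ) φ)
    simpa [ht] using h
  have hder : derivative φ = C a * ((X - C t₂) * (X - C t₃) + (X - C t₁) * (X - C t₃) +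
      (X - C t₁) * (X - C t₂)) := by
    rw [hφ]
    simp only [derivative_mul, derivative_C, derivative_sub, derivative_X]
    ring
  have hcard : (({t₁, t₂, t₃} : Finset ℝ).card) = 3 := by
    rw [Finset.card_eq_three]
    exact ⟨_, _, _, h₁₂, h₁₃, h₂₃, rfl⟩
  -- Lagrange interpolation: both sides have degree below 3 and agree at the three roots, where the
  -- remainder equals the dividend. The right side is `a² ∑ ψ(tᵢ) ∏_{j ≠ i} (X - tⱼ)`.
  refine eq_of_degrees_lt_of_eval_finset_eq ({t₁, t₂, t₃} : Finset ℝ) ?_ ?_ ?_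
  · rw [hcard]
    exact (degree_mod_lt _ hφ0).trans_eq hdeg
  · rw [hcard]
    exact degree_quadratic_lt
  · intro t ht
    simp only [Finset.mem_insert, Finset.mem_singleton] at ht
    rw [heval t (by rw [hφ]; rcases ht with rfl | rfl | rfl <;> simp), hder]
    rcases ht with rfl | rfl | rfl <;> simp <;> ring

variable {f g : TernaryForm} {a t₁ t₂ t₃ : ℝ}

section

variable {b c d : ℝ}

theorem coeff_cubic_three : (C a * X ^ 3 + C b * X ^ 2 + C c * X + C d).coeff 3 = a := by
  simp [coeff_X_pow]

theorem coeff_cubic_two : (C a * X ^ 3 + C b * X ^ 2 + C c * X + C d).coeff 2 = b := by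
  simp [coeff_X_pow]

theorem coeff_cubic_one : (C a * X ^ 3 + C b * X ^ 2 + C c * X + C d).coeff 1 = c := by
  simp [coeff_X_pow]

theorem coeff_cubic_zero : (C a * X ^ 3 + C b * X ^ 2 + C c * X + C d).coeff 0 = d := by
  simp

theorem coeff_quadratic :
    (C b * X ^ 2 + C c * X + C d).coeff 2 = b ∧ (C b * X ^ 2 + C c * X + C d).coeff 1 = c ∧
      (C b * X ^ 2 + C c * X + C d).coeff 0 = d := by
  refine ⟨?_, ?_, ?_⟩ <;> simp [coeff_X, coeff_C, coeff_X_pow]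

end

theorem phi_coeffs (h : phi f g = C a * ((X - C t₁) * (X - C t₂) * (X - C t₃))) :
    (phi f g).coeff 3 = a ∧ (phi f g).coeff 2 = -a * (t₁ + t₂ + t₃) ∧
      (phi f g).coeff 1 = a * (t₁ * t₂ + t₁ * t₃ + t₂ * t₃) ∧
      (phi f g).coeff 0 = -a * (t₁ * t₂ * t₃) := by
  have : phi f g = C a * X ^ 3 + C (-a * (t₁ + t₂ + t₃)) * X ^ 2 +
      C (a * (t₁ * t₂ + t₁ * t₃ + t₂ * t₃)) * X + C (-a * (t₁ * t₂ * t₃)) := by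
    rw [h]
    simp only [map_mul, map_add, map_neg]
    ring
  rw [this]
  exact ⟨coeff_cubic_three, coeff_cubic_two, coeff_cubic_one, coeff_cubic_zero⟩

/-- `A₁` alone carries the odd power `a⁵`; the factor `Φ₃₀ = a` makes its sign independent of that
of `a`. -/
theorem subresultants_eq (ha : a ≠ 0) (h₁₂ : t₁ ≠ t₂) (h₁₃ : t₁ ≠ t₃) (h₂₃ : t₂ ≠ t₃)
    (h : phi f g = C a * ((X - C t₁) * (X - C t₂) * (X - C t₃)))
    {s₁ s₂ s₃ : ℝ} (hs₁ : (psi f g).eval t₁ = s₁) (hs₂ : (psi f g).eval t₂ = s₂)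
    (hs₃ : (psi f g).eval t₃ = s₃) :
    p2 f g = a ^ 2 * (s₁ + s₂ + s₃) ∧
    Phi30 f g * A1 f g = a ^ 6 *
      (s₁ * s₂ * (t₁ - t₂) ^ 2 + s₁ * s₃ * (t₁ - t₃) ^ 2 + s₂ * s₃ * (t₂ - t₃) ^ 2) ∧
    A0 f g = a ^ 8 * (s₁ * s₂ * s₃ * ((t₁ - t₂) * (t₁ - t₃) * (t₂ - t₃)) ^ 2) := by
  obtain ⟨c3, c2, c1, c0⟩ := phi_coeffs h
  have hP := remainder_eq ha h₁₂ h₁₃ h₂₃ h (psi f g)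
  rw [hs₁, hs₂, hs₃] at hP
  have hP' : P f g = (C a * psi f g * derivative (phi f g)) % phi f g := by
    rw [P, Phi30, c3]
  rw [hP] at hP'
  have hq := coeff_quadratic (b := a ^ 2 * (s₁ + s₂ + s₃))
    (c := -a ^ 2 * (s₁ * (t₂ + t₃) + s₂ * (t₁ + t₃) + s₃ * (t₁ + t₂)))
    (d := a ^ 2 * (s₁ * (t₂ * t₃) + s₂ * (t₁ * t₃) + s₃ * (t₁ * t₂)))
  rw [← hP'] at hq
  obtain ⟨q2, q1, q0⟩ := hq
  refine ⟨q2, ?_, ?_⟩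
  · rw [Phi30, A1, sr1, c3, c2, c1, q2, q1, q0, det_fin_three]
    simp
    ring
  · rw [A0, sr0, c3, c2, c1, c0, q2, q1, q0]
    simp [det_succ_row_zero, Fin.sum_univ_succ, Fin.succAbove]
    ring

theorem signs_of_neg_neg_neg (ha : a ≠ 0) (h₁₂ : t₁ ≠ t₂) (h₁₃ : t₁ ≠ t₃) (h₂₃ : t₂ ≠ t₃)
    (h : phi f g = C a * ((X - C t₁) * (X - C t₂) * (X - C t₃)))
    (hs₁ : (psi f g).eval t₁ < 0) (hs₂ : (psi f g).eval t₂ < 0) (hs₃ : (psi f g).eval t₃ < 0) :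
    A0 f g < 0 ∧ p2 f g < 0 ∧ 0 < Phi30 f g * A1 f g := by
  obtain ⟨e2, e1, e0⟩ := subresultants_eq ha h₁₂ h₁₃ h₂₃ h rfl rfl rfl
  have d₁₂ := sub_ne_zero.2 h₁₂
  have d₁₃ := sub_ne_zero.2 h₁₃
  have d₂₃ := sub_ne_zero.2 h₂₃
  rw [e2, e1, e0]
  refine ⟨?_, ?_, ?_⟩
  · exact mul_neg_of_pos_of_neg (by positivity)
      (mul_neg_of_neg_of_pos (mul_neg_of_pos_of_neg (mul_pos_of_neg_of_neg hs₁ hs₂) hs₃)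
        (by positivity))
  · exact mul_neg_of_pos_of_neg (by positivity) (by linarith)
  · have := mul_pos_of_neg_of_neg hs₁ hs₂
    have := mul_pos_of_neg_of_neg hs₁ hs₃
    have := mul_pos_of_neg_of_neg hs₂ hs₃
    positivity

theorem signs_of_neg_pos_pos (ha : a ≠ 0) (h₁₂ : t₁ ≠ t₂) (h₁₃ : t₁ ≠ t₃) (h₂₃ : t₂ ≠ t₃)
    (h : phi f g = C a * ((X - C t₁) * (X - C t₂) * (X - C t₃)))
    (hs₁ : (psi f g).eval t₁ < 0) (hs₂ : 0 < (psi f g).eval t₂) (hs₃ : 0 < (psi f g).eval t₃) :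
    A0 f g < 0 ∧ (0 < p2 f g ∨ Phi30 f g * A1 f g < 0 ∨ (p2 f g = 0 ∧ A1 f g = 0)) := by
  obtain ⟨e2, e1, e0⟩ := subresultants_eq ha h₁₂ h₁₃ h₂₃ h rfl rfl rfl
  have d₁₂ := sub_ne_zero.2 h₁₂
  have d₁₃ := sub_ne_zero.2 h₁₃
  have d₂₃ := sub_ne_zero.2 h₂₃
  have hΦ : Phi30 f g ≠ 0 := by
    rw [Phi30, (phi_coeffs h).1]
    exact ha
  generalize (psi f g).eval t₁ = s₁ at *
  generalize (psi f g).eval t₂ = s₂ at *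
  generalize (psi f g).eval t₃ = s₃ at *
  have a2 : 0 < a ^ 2 := by positivity
  have a6 : 0 < a ^ 6 := by positivity
  have hk : 0 < s₂ * (t₁ - t₂) ^ 2 + s₃ * (t₁ - t₃) ^ 2 := by positivity
  -- The 2×2 Hankel minor `m₀m₂ - m₁²`, with moments taken about `t₁`: the negative weight `s₁`
  -- drops out of `m₁` and `m₂`, so `m₂ > 0`. Hence `m₀ ≤ 0` makes the minor nonpositive, and it
  -- vanishes only if `m₀ = m₁ = 0`.
  have key : s₁ * s₂ * (t₁ - t₂) ^ 2 + s₁ * s₃ * (t₁ - t₃) ^ 2 + s₂ * s₃ * (t₂ - t₃) ^ 2 =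
      (s₁ + s₂ + s₃) * (s₂ * (t₁ - t₂) ^ 2 + s₃ * (t₁ - t₃) ^ 2) -
        (s₂ * (t₁ - t₂) + s₃ * (t₁ - t₃)) ^ 2 := by ring
  have hsq := sq_nonneg (s₂ * (t₁ - t₂) + s₃ * (t₁ - t₃))
  refine ⟨?_, ?_⟩
  · rw [e0]
    exact mul_neg_of_pos_of_neg (by positivity)
      (mul_neg_of_neg_of_pos (mul_neg_of_neg_of_pos (mul_neg_of_neg_of_pos hs₁ hs₂) hs₃)
        (by positivity))
  · rcases lt_trichotomy (s₁ + s₂ + s₃) 0 with hs | hs | hs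
    · refine Or.inr (Or.inl ?_)
      rw [e1, key]
      exact mul_neg_of_pos_of_neg a6 (by linarith [mul_neg_of_neg_of_pos hs hk])
    · rw [e2, hs, mul_zero]
      rw [key, hs, zero_mul, zero_sub] at e1
      rcases hsq.eq_or_lt with h0 | h0
      · refine Or.inr (Or.inr ⟨rfl, ?_⟩)
        rw [← h0, neg_zero, mul_zero] at e1
        exact (mul_eq_zero.1 e1).resolve_left hΦ
      · refine Or.inr (Or.inl ?_)
        rw [e1]
        exact mul_neg_of_pos_of_neg a6 (by linarith)
    · refine Or.inl ?_
      rw [e2]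
      exact mul_pos a2 hs

/-! ### Symmetric matrices of the forms in a pencil -/

theorem toMatrix'_add (Q R : TernaryForm) :
    QuadraticForm.toMatrix' (Q + R) = QuadraticForm.toMatrix' Q + QuadraticForm.toMatrix' R := by
  simp [QuadraticForm.toMatrix']

theorem toMatrix'_mon (i j : Fin 3) : QuadraticForm.toMatrix' (mon i j) =
    (1 / 2 : ℝ) • (single i j 1 + single j i 1) := by
  ext k l
  rw [QuadraticForm.toMatrix', LinearMap.toMatrix₂'_apply, mon, QuadraticMap.proj,
    QuadraticMap.associated_linMulLin]
  fin_cases i <;> fin_cases j <;> fin_cases k <;> fin_cases l <;>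
    simp [LinearMap.compl₁₂_apply, single] <;> norm_num

theorem eval_pencilMatrix (f g : TernaryForm) (t : ℝ) :
    (pencilMatrix f g).map (evalRingHom t) = QuadraticForm.toMatrix' (t • f + g) := by
  rw [toMatrix'_add, QuadraticForm.toMatrix'_smul]
  ext i j
  simp [pencilMatrix]
  ring

theorem eval_phi (f g : TernaryForm) (t : ℝ) :
    (phi f g).eval t = (QuadraticForm.toMatrix' (t • f + g)).det := by
  rw [← eval_pencilMatrix, phi, ← coe_evalRingHom, RingHom.map_det, RingHom.mapMatrix_apply]

/-- Both sides are the sum of the principal 2×2 minors. -/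
theorem charpoly_coeff_one (M : Matrix (Fin 3) (Fin 3) ℝ) :
    M.charpoly.coeff 1 = M.adjugate.trace := by
  have : M.charpoly = X ^ 3 + C (-M.trace) * X ^ 2 + C M.adjugate.trace * X + C (-M.det) := by
    rw [charpoly, charmatrix, det_fin_three, det_fin_three, adjugate_fin_three, trace_fin_three,
      trace_fin_three]
    simp
    ring
  rw [this]
  simp [coeff_C]

theorem eval_psi (f g : TernaryForm) (t : ℝ) :
    (psi f g).eval t = (QuadraticForm.toMatrix' (t • f + g)).adjugate.trace := by
  rw [← eval_pencilMatrix, ← charpoly_coeff_one, charpoly_map, coeff_map, psi, coe_evalRingHom]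

theorem det_toMatrix'_pullback (e : (Fin 3 → ℝ) ≃ₗ[ℝ] (Fin 3 → ℝ)) (Q : TernaryForm) :
    (QuadraticForm.toMatrix' (pullback e Q)).det =
      (LinearMap.toMatrix' e.toLinearMap).det ^ 2 * (QuadraticForm.toMatrix' Q).det := by
  change (QuadraticForm.toMatrix' (Q.comp e.toLinearMap)).det = _
  rw [QuadraticForm.toMatrix'_comp, det_mul, det_mul, det_transpose]
  ring

theorem det_toMatrix'_equiv_ne_zero (e : (Fin 3 → ℝ) ≃ₗ[ℝ] (Fin 3 → ℝ)) :
    (LinearMap.toMatrix' e.toLinearMap).det ≠ 0 := by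
  rw [LinearMap.det_toMatrix']
  exact e.isUnit_det'.ne_zero

/-- A linear change of coordinates multiplies the trace of a rank one adjugate by a positive
number. -/
theorem exists_trace_adjugate_pullback (e : (Fin 3 → ℝ) ≃ₗ[ℝ] (Fin 3 → ℝ)) (Q : TernaryForm)
    {c : ℝ} {v : Fin 3 → ℝ} (hv : v ≠ 0)
    (hQ : (QuadraticForm.toMatrix' Q).adjugate = c • vecMulVec v v) :
    ∃ k : ℝ, 0 < k ∧ (QuadraticForm.toMatrix' (pullback e Q)).adjugate.trace = c * k := by
  set E := LinearMap.toMatrix' e.toLinearMap with hE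
  have hdet : E.adjugate.det ≠ 0 := by
    rw [det_adjugate]
    exact pow_ne_zero _ (det_toMatrix'_equiv_ne_zero e)
  -- Since `adj(EᵀME) = adj(E) adj(M) adj(E)ᵀ`, the new adjugate is `c • w wᵀ`, with trace `c` times
  -- `w ⬝ᵥ w`.
  set w := E.adjugate *ᵥ v with hw
  have hw0 : w ≠ 0 := fun h => hv (eq_zero_of_mulVec_eq_zero hdet h)
  refine ⟨w ⬝ᵥ w, ?_, ?_⟩
  · have h0 : w ⬝ᵥ w ≠ 0 := fun h => hw0 (dotProduct_self_eq_zero.1 h)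
    have h1 : 0 ≤ w ⬝ᵥ w := Finset.sum_nonneg fun i _ => mul_self_nonneg (w i)
    exact lt_of_le_of_ne h1 (Ne.symm h0)
  · change (QuadraticForm.toMatrix' (Q.comp e.toLinearMap)).adjugate.trace = _
    rw [QuadraticForm.toMatrix'_comp, ← hE, adjugate_mul_distrib, adjugate_mul_distrib, hQ,
      ← adjugate_transpose, Matrix.smul_mul, Matrix.mul_smul, trace_smul, vecMulVec_mul, mul_vecMulVec,
      vecMul_transpose, ← hw, trace_vecMulVec, smul_eq_mul]

/-! ### Coordinates in a pencil -/

theorem pullback_injective (e : (Fin 3 → ℝ) ≃ₗ[ℝ] (Fin 3 → ℝ)) :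
    Function.Injective (pullback e) := by
  intro Q R h
  ext x
  have hx : Q (e (e.symm x)) = R (e (e.symm x)) :=
    congrArg (fun S : TernaryForm => S (e.symm x)) h
  simpa using hx

theorem ProjEquiv.exists_coords {F G f g : TernaryForm}
    (h : ProjEquiv (pencil F G) (pencil f g))
    (hFG : ∀ x y : ℝ, x • F + y • G = 0 → x = 0 ∧ y = 0) :
    ∃ (e : (Fin 3 → ℝ) ≃ₗ[ℝ] (Fin 3 → ℝ)) (α β γ δ : ℝ), α * δ - β * γ ≠ 0 ∧
      f = pullback e (α • F + β • G) ∧ g = pullback e (γ • F + δ • G) := by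
  obtain ⟨e, he⟩ := h
  have hf : f ∈ (pencil F G).map (pullback e) := he ▸ Submodule.subset_span (by simp)
  have hg : g ∈ (pencil F G).map (pullback e) := he ▸ Submodule.subset_span (by simp)
  have hF : pullback e F ∈ pencil f g :=
    he ▸ Submodule.mem_map_of_mem (Submodule.subset_span (by simp))
  have hG : pullback e G ∈ pencil f g :=
    he ▸ Submodule.mem_map_of_mem (Submodule.subset_span (by simp))
  obtain ⟨f₀, hf₀, rfl⟩ := hf
  obtain ⟨g₀, hg₀, rfl⟩ := hg
  obtain ⟨α, β, rfl⟩ := Submodule.mem_span_pair.1 hf₀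
  obtain ⟨γ, δ, rfl⟩ := Submodule.mem_span_pair.1 hg₀
  obtain ⟨x, y, hxy⟩ := Submodule.mem_span_pair.1 hF
  obtain ⟨z, w, hzw⟩ := Submodule.mem_span_pair.1 hG
  refine ⟨e, α, β, γ, δ, ?_, rfl, rfl⟩
  rw [← map_smul, ← map_smul, ← map_add] at hxy hzw
  have hxy := pullback_injective e hxy
  have hzw := pullback_injective e hzw
  obtain ⟨h1, h2⟩ := hFG (x * α + y * γ - 1) (x * β + y * δ) (by
    rw [← sub_eq_zero] at hxy
    rw [← hxy]
    module)
  obtain ⟨h3, h4⟩ := hFG (z * α + w * γ) (z * β + w * δ - 1) (by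
    rw [← sub_eq_zero] at hzw
    rw [← hzw]
    module)
  intro h0
  -- The two change-of-basis matrices are mutually inverse, so their determinants multiply to 1.
  have : (x * w - y * z) * (α * δ - β * γ) = 1 := by
    linear_combination (z * β + w * δ) * h1 - (z * α + w * γ) * h2 + h4
  rw [h0, mul_zero] at this
  exact zero_ne_one this

theorem smul_pullback_add (e : (Fin 3 → ℝ) ≃ₗ[ℝ] (Fin 3 → ℝ)) (F G : TernaryForm)
    (t α β γ δ : ℝ) :
    t • pullback e (α • F + β • G) + pullback e (γ • F + δ • G) =
      pullback e ((t * α + γ) • F + (t * β + δ) • G) := by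
  rw [← map_smul, ← map_add]
  congr 1
  module

/-! ### The two orbits -/

theorem toMatrix'_real (u w : ℝ) :
    QuadraticForm.toMatrix' (u • (mon 0 0 - mon 1 1) + w • (mon 0 0 - mon 2 2)) =
      !![u + w, 0, 0; 0, -u, 0; 0, 0, -w] := by
  have : u • (mon 0 0 - mon 1 1) + w • (mon 0 0 - mon 2 2) =
      (u + w) • mon 0 0 + ((-u) • mon 1 1 + (-w) • mon 2 2) := by module
  rw [this]
  simp only [toMatrix'_add, QuadraticForm.toMatrix'_smul, toMatrix'_mon]
  ext i j
  fin_cases i <;> fin_cases j <;> simp [single] <;> ring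

theorem toMatrix'_imaginary (u w : ℝ) :
    QuadraticForm.toMatrix' (u • (mon 0 0 + mon 1 1 + mon 2 2) + w • mon 0 2) =
      !![u, 0, w / 2; 0, u, 0; w / 2, 0, u] := by
  simp only [toMatrix'_add, QuadraticForm.toMatrix'_smul, toMatrix'_mon]
  ext i j
  fin_cases i <;> fin_cases j <;> simp [single] <;> ring

theorem det_toMatrix'_real (u w : ℝ) :
    (QuadraticForm.toMatrix' (u • (mon 0 0 - mon 1 1) + w • (mon 0 0 - mon 2 2))).det =
      u * w * (u + w) := by
  rw [toMatrix'_real, det_fin_three]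
  simp
  ring

theorem det_toMatrix'_imaginary (u w : ℝ) :
    (QuadraticForm.toMatrix' (u • (mon 0 0 + mon 1 1 + mon 2 2) + w • mon 0 2)).det =
      u * (2 * u + w) * (2 * u - w) / 4 := by
  rw [toMatrix'_imaginary, det_fin_three]
  simp
  ring

theorem exists_root_linear {l : ℝ} (hl : l ≠ 0) (m : ℝ) : ∃ r, r * l + m = 0 :=
  ⟨-m / l, by field_simp; ring⟩

theorem phi_eq_of_forall (h : ∀ t, (phi f g).eval t = a * ((t - t₁) * (t - t₂) * (t - t₃))) :
    phi f g = C a * ((X - C t₁) * (X - C t₂) * (X - C t₃)) :=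
  Polynomial.funext fun t => by simp [h]

theorem OrbitI.signs (hf : QuadraticForm.discr' f ≠ 0) (h : OrbitI (pencil f g)) :
    A0 f g < 0 ∧ p2 f g < 0 ∧ 0 < Phi30 f g * A1 f g := by
  obtain ⟨e, α, β, γ, δ, hd, rfl, rfl⟩ := ProjEquiv.exists_coords h (by
    intro x y hxy
    have hM := toMatrix'_real x y
    rw [hxy] at hM
    have h1 := congrFun₂ hM 1 1
    have h2 := congrFun₂ hM 2 2
    simp [QuadraticForm.toMatrix'] at h1 h2
    exact ⟨h1, h2⟩)
  rw [QuadraticForm.discr', det_toMatrix'_pullback, det_toMatrix'_real] at hf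
  have hD := det_toMatrix'_equiv_ne_zero e
  have hα : α ≠ 0 := by rintro rfl; simp at hf
  have hβ : β ≠ 0 := by rintro rfl; simp at hf
  have hαβ : α + β ≠ 0 := by
    intro h0
    simp [h0] at hf
  have hsign : ∀ (t c : ℝ) (v : Fin 3 → ℝ), v ≠ 0 → c ≠ 0 →
      adjugate !![(t * α + γ) + (t * β + δ), 0, 0; 0, -(t * α + γ), 0; 0, 0, -(t * β + δ)] =
        (-c ^ 2) • vecMulVec v v →
      (psi (pullback e (α • (mon 0 0 - mon 1 1) + β • (mon 0 0 - mon 2 2)))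
        (pullback e (γ • (mon 0 0 - mon 1 1) + δ • (mon 0 0 - mon 2 2)))).eval t < 0 := by
    intro t c v hv hc hadj
    rw [← toMatrix'_real] at hadj
    obtain ⟨k, hk, hk'⟩ := exists_trace_adjugate_pullback e _ hv hadj
    rw [eval_psi, smul_pullback_add, hk', neg_mul, neg_lt_zero]
    positivity
  obtain ⟨r₁, h₁⟩ := exists_root_linear hα γ
  obtain ⟨r₂, h₂⟩ := exists_root_linear hβ δ
  obtain ⟨r₃, h₃⟩ := exists_root_linear hαβ (γ + δ)
  refine signs_of_neg_neg_neg
    (a := (LinearMap.toMatrix' e.toLinearMap).det ^ 2 * (α * β * (α + β)))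
    (t₁ := r₁) (t₂ := r₂) (t₃ := r₃) (by positivity) ?_ ?_ ?_ (phi_eq_of_forall fun t => ?_)
    ?_ ?_ ?_
  -- If two of the three linear factors of the determinant vanished at the same `t`, then `αδ - βγ`
  -- would be 0.
  · rintro rfl
    exact hd (by linear_combination α * h₂ - β * h₁)
  · rintro rfl
    exact hd (by linear_combination α * (h₃ - h₁) - β * h₁)
  · rintro rfl
    exact hd (by linear_combination α * h₂ - β * (h₃ - h₂))
  · rw [eval_phi, smul_pullback_add, det_toMatrix'_pullback, det_toMatrix'_real]
    have e₁ : t * α + γ = α * (t - r₁) := by linear_combination h₁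
    have e₂ : t * β + δ = β * (t - r₂) := by linear_combination h₂
    have e₃ : t * α + γ + (t * β + δ) = (α + β) * (t - r₃) := by linear_combination h₃
    rw [e₃, e₁, e₂]
    ring
  -- The degenerate members are multiples of `x² - z²`, `x² - y²` and `y² - z²`, with vertices at
  -- the coordinate points.
  · refine hsign _ (r₁ * β + δ) ![0, 1, 0] (fun h0 => by simpa using congrFun h0 1)
      (fun h0 => hd (by linear_combination α * h0 - β * h₁)) ?_
    rw [h₁, adjugate_fin_three_of]
    ext i j
    fin_cases i <;> fin_cases j <;> simp [vecMulVec] <;> ring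
  · refine hsign _ (r₂ * α + γ) ![0, 0, 1] (fun h0 => by simpa using congrFun h0 2)
      (fun h0 => hd (by linear_combination α * h₂ - β * h0)) ?_
    rw [h₂, adjugate_fin_three_of]
    ext i j
    fin_cases i <;> fin_cases j <;> simp [vecMulVec] <;> ring
  · have hu : r₃ * β + δ = -(r₃ * α + γ) := by linear_combination h₃
    refine hsign _ (r₃ * α + γ) ![1, 0, 0] (fun h0 => by simpa using congrFun h0 0)
      (fun h0 => hd (by linear_combination α * (h₃ - h0) - β * h0)) ?_
    rw [hu, adjugate_fin_three_of]
    ext i j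
    fin_cases i <;> fin_cases j <;> simp [vecMulVec] <;> ring

theorem OrbitIa.signs (hf : QuadraticForm.discr' f ≠ 0) (h : OrbitIa (pencil f g)) :
    A0 f g < 0 ∧ (0 < p2 f g ∨ Phi30 f g * A1 f g < 0 ∨ (p2 f g = 0 ∧ A1 f g = 0)) := by
  obtain ⟨e, α, β, γ, δ, hd, rfl, rfl⟩ := ProjEquiv.exists_coords h (by
    intro x y hxy
    have hM := toMatrix'_imaginary x y
    rw [hxy] at hM
    have h1 := congrFun₂ hM 1 1
    have h2 := congrFun₂ hM 0 2
    simp [QuadraticForm.toMatrix'] at h1 h2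
    exact ⟨h1.symm, by linarith⟩)
  rw [QuadraticForm.discr', det_toMatrix'_pullback, det_toMatrix'_imaginary] at hf
  have hD := det_toMatrix'_equiv_ne_zero e
  have hα : α ≠ 0 := by rintro rfl; simp at hf
  have hp : 2 * α + β ≠ 0 := by
    intro h0
    simp [h0] at hf
  have hm : 2 * α - β ≠ 0 := by
    intro h0
    simp [h0] at hf
  have hpsi : ∀ (t c : ℝ) (v : Fin 3 → ℝ), v ≠ 0 →
      adjugate !![t * α + γ, 0, (t * β + δ) / 2; 0, t * α + γ, 0;
        (t * β + δ) / 2, 0, t * α + γ] = c • vecMulVec v v →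
      ∃ k : ℝ, 0 < k ∧ (psi (pullback e (α • (mon 0 0 + mon 1 1 + mon 2 2) + β • mon 0 2))
        (pullback e (γ • (mon 0 0 + mon 1 1 + mon 2 2) + δ • mon 0 2))).eval t = c * k := by
    intro t c v hv hadj
    rw [← toMatrix'_imaginary] at hadj
    rw [eval_psi, smul_pullback_add]
    exact exists_trace_adjugate_pullback e _ hv hadj
  obtain ⟨r₁, h₁⟩ := exists_root_linear hα γ
  obtain ⟨r₂, h₂⟩ := exists_root_linear hp (2 * γ + δ)
  obtain ⟨r₃, h₃⟩ := exists_root_linear hm (2 * γ - δ)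
  refine signs_of_neg_pos_pos
    (a := (LinearMap.toMatrix' e.toLinearMap).det ^ 2 * (α * (2 * α + β) * (2 * α - β) / 4))
    (t₁ := r₁) (t₂ := r₂) (t₃ := r₃) (by positivity) ?_ ?_ ?_ (phi_eq_of_forall fun t => ?_)
    ?_ ?_ ?_
  · rintro rfl
    exact hd (by linear_combination α * (h₂ - 2 * h₁) - β * h₁)
  · rintro rfl
    exact hd (by linear_combination α * (2 * h₁ - h₃) - β * h₁)
  · rintro rfl
    exact hd (by linear_combination α * ((h₂ - h₃) / 2) - β * ((h₂ + h₃) / 4))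
  · rw [eval_phi, smul_pullback_add, det_toMatrix'_pullback, det_toMatrix'_imaginary]
    have e₁ : t * α + γ = α * (t - r₁) := by linear_combination h₁
    have e₂ : 2 * (t * α + γ) + (t * β + δ) = (2 * α + β) * (t - r₂) := by
      linear_combination h₂
    have e₃ : 2 * (t * α + γ) - (t * β + δ) = (2 * α - β) * (t - r₃) := by
      linear_combination h₃
    rw [e₃, e₂, e₁]
    ring
  -- The member at `r₁` is a multiple of `xz`, a real line pair, hence the negative sign.
  · have hw : r₁ * β + δ ≠ 0 := fun h0 => hd (by linear_combination α * h0 - β * h₁)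
    obtain ⟨k, hk, hk'⟩ := hpsi r₁ (-((r₁ * β + δ) / 2) ^ 2) ![0, 1, 0]
      (fun h0 => by simpa using congrFun h0 1) (by
        rw [h₁, adjugate_fin_three_of]
        ext i j
        fin_cases i <;> fin_cases j <;> simp [vecMulVec] <;> ring)
    rw [hk', neg_mul, neg_lt_zero]
    positivity
  -- The members at `r₂` and `r₃` are multiples of `(x ∓ z)² + y²`, imaginary line pairs with real
  -- vertices `(1, 0, ±1)`.
  · have hw : r₂ * α + γ ≠ 0 := fun h0 =>
      hd (by linear_combination α * (h₂ - 2 * h0) - β * h0)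
    have hu : (r₂ * β + δ) / 2 = -(r₂ * α + γ) := by linear_combination h₂ / 2
    obtain ⟨k, hk, hk'⟩ := hpsi r₂ ((r₂ * α + γ) ^ 2) ![1, 0, 1]
      (fun h0 => by simpa using congrFun h0 0) (by
        rw [hu, adjugate_fin_three_of]
        ext i j
        fin_cases i <;> fin_cases j <;> simp [vecMulVec] <;> ring)
    rw [hk']
    positivity
  · have hw : r₃ * α + γ ≠ 0 := fun h0 =>
      hd (by linear_combination α * (2 * h0 - h₃) - β * h0)
    have hu : (r₃ * β + δ) / 2 = r₃ * α + γ := by linear_combination -h₃ / 2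
    obtain ⟨k, hk, hk'⟩ := hpsi r₃ ((r₃ * α + γ) ^ 2) ![1, 0, -1]
      (fun h0 => by simpa using congrFun h0 0) (by
        rw [hu, adjugate_fin_three_of]
        ext i j
        fin_cases i <;> fin_cases j <;> simp [vecMulVec] <;> ring)
    rw [hk']
    positivity

end ConicPencil

theorem mainTheorem7 (f g : TernaryForm)
    (hf : QuadraticForm.discr' f ≠ 0) (hg : QuadraticForm.discr' g ≠ 0)
    (hfg : ConicPencil.OrbitI (ConicPencil.pencil f g) ∨
      ConicPencil.OrbitIa (ConicPencil.pencil f g)) :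
    ConicPencil.A0 f g < 0 ∧
    (ConicPencil.OrbitI (ConicPencil.pencil f g) ↔
      ConicPencil.p2 f g < 0 ∧ 0 < ConicPencil.Phi30 f g * ConicPencil.A1 f g) ∧
    (ConicPencil.OrbitIa (ConicPencil.pencil f g) ↔
      0 < ConicPencil.p2 f g ∨ ConicPencil.Phi30 f g * ConicPencil.A1 f g < 0 ∨
        (ConicPencil.p2 f g = 0 ∧ ConicPencil.A1 f g = 0)) := by
  have hI := ConicPencil.OrbitI.signs (g := g) hf
  have hIa := ConicPencil.OrbitIa.signs (g := g) hf
  refine ⟨hfg.elim (fun h => (hI h).1) fun h => (hIa h).1,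
    ⟨fun h => (hI h).2, fun h => hfg.resolve_right fun h' => ?_⟩,
    ⟨fun h => (hIa h).2, fun h => hfg.resolve_left fun h' => ?_⟩⟩
  · rcases (hIa h').2 with h1 | h1 | h1 <;> linarith [h.1, h.2, h1]
  · rcases h with h1 | h1 | h1 <;> linarith [(hI h').2.1, (hI h').2.2, h1]
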